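/- Let $\Bbbk$ be a field of characteristic $0$, let $A$ be a commutative (associative, unital) $\Bbbk$-algebra, let $\mathfrak h$ be a Lie algebra over $\Bbbk$, and let $\rho\colon\mathfrak h\to\mathrm{Der}_{\Bbbk}(A)$, $v\mapsto v^\sharp$, be a morphism of Lie algebras. The *transformation Lie–Rinehart algebra* $A\rtimes\mathfrak h$ is the $A$-module $A\otimes_{\Bbbk}\mathfrak h$ with anchor $f\otimes v\mapsto f\,v^\sharp$ and bracket $$[f\otimes v,\,g\otimes w]=fg\otimes[v,w]+f\,v^\sharp(g)\otimes w-g\,w^\sharp(f)\otimes v .$$ Its *universal enveloping algebra* $\mathcal U_A(A\rtimes\mathfrak h)$ is the universal $\Bbbk$-algebra equipped with an algebra morphism $\iota_A\colon A\to \mathcal U_A(A\rtimes\mathfrak h)$ and a Lie algebra morphism $\iota\colon A\rtimes\mathfrak h\to \mathcal U_A(A\rtimes\mathfrak h)$ such that $\iota(aX)=\iota_A(a)\,\iota(X)$ and $\iota(X)\,\iota_A(a)-\iota_A(a)\,\iota(X)=\iota_A(X(a))$, where $X(a)$ denotes the anchor of $X$ applied to $a$. It is an $A$-coalgebra for the left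 $A$-action $a\,u=\iota_A(a)u$, with $\Delta(1)=1\otimes_A1$, $\Delta(\iota(X)u)=(\iota(X)\otimes_A 1+1\otimes_A\iota(X))\,\Delta(u)$, $\varepsilon(1)=1$, $\varepsilon(\iota(X)u)=X(\varepsilon(u))$. Let $U(\mathfrak h)$ be the universal enveloping algebra of $\mathfrak h$, with its bialgebra structure for which the elements of $\mathfrak h$ are primitive; $\rho$ extends to an action of $U(\mathfrak h)$ on $A$ which makes $A$ a $U(\mathfrak h)$-module algebra. The *smash product* $A\# U(\mathfrak h)$ is the vector space $A\otimes_{\Bbbk}U(\mathfrak h)$ (with $a\# u:=a\otimes u$), with unit $1\# 1$, multiplication $(a\# u)(b\# u')=\sum a\,(u_{(1)}\cdot b)\# u_{(2)}u'$, and with the $A$-coalgebra structure $\Delta(a\# u)=\sum (a\# u_{(1)})\otimes_A(1\# u_{(2)})$, $\varepsilon(a\# u)=a\,\varepsilon(u)$. Then there is an isomorphism of $\Bbbk$-algebras $$\Phi\colon\ \mathcal U_A(A\rtimes\mathfrak h)\ \xrightarrow{\ \sim\ }\ A\# U(\mathfrak h)$$ such that $\Phi(\iota_A(a))=a\# 1$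 and $\Phi(\iota(f\otimes v))=f\# v$ for all $a,f\in A$, $v\in\mathfrak h$, and $\Phi$ is also an isomorphism of $A$-coalgebras (so $\Phi$ is an isomorphism of left bialgebroids over $A$). -/

import Mathlib

open scoped TensorProduct

set_option linter.unusedSectionVars false

namespace LieRinehart

section Enveloping

variable (k A L : Type*) [CommRing k] [CommRing A] [Algebra k A] [LieRing L] [LieAlgebra k L]
  [Module A L] [LieRingModule L A] [LieRinehartRing A L] [LieRinehartAlgebra k A L]

/-- The relations which say that `a ↦ (a, 0)` is a morphism of unital algebras, that
`x ↦ (0, x)` is a morphism of Lie algebras, and that the two compatibility conditions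
`ι(a x) = ι(a) ι(x)` and `ι(x) ι(a) - ι(a) ι(x) = ι(x(a))` hold. -/
inductive EnvelopingRel : TensorAlgebra k (A × L) → TensorAlgebra k (A × L) → Prop
  | one : EnvelopingRel (TensorAlgebra.ι k ((1 : A), (0 : L))) 1
  | mul (a b : A) : EnvelopingRel (TensorAlgebra.ι k (a * b, (0 : L)))
      (TensorAlgebra.ι k (a, (0 : L)) * TensorAlgebra.ι k (b, (0 : L)))
  | lie (x y : L) : EnvelopingRel (TensorAlgebra.ι k ((0 : A), ⁅x, y⁆))
      (TensorAlgebra.ι k ((0 : A), x) * TensorAlgebra.ι k ((0 : A), y)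
        - TensorAlgebra.ι k ((0 : A), y) * TensorAlgebra.ι k ((0 : A), x))
  | smul (a : A) (x : L) : EnvelopingRel (TensorAlgebra.ι k ((0 : A), a • x))
      (TensorAlgebra.ι k (a, (0 : L)) * TensorAlgebra.ι k ((0 : A), x))
  | anchor (x : L) (a : A) : EnvelopingRel
      (TensorAlgebra.ι k ((0 : A), x) * TensorAlgebra.ι k (a, (0 : L))
        - TensorAlgebra.ι k (a, (0 : L)) * TensorAlgebra.ι k ((0 : A), x))
      (TensorAlgebra.ι k (⁅x, a⁆, (0 : L)))

/-- The universal enveloping algebra `𝒰_A(L)` of a Lie-Rinehart algebra `L` over the commutative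
`k`-algebra `A`. Its universal property is `Enveloping.lift` together with `Enveloping.hom_ext`. -/
def Enveloping : Type _ := RingQuot (EnvelopingRel k A L)

namespace Enveloping

noncomputable instance : Ring (Enveloping k A L) :=
  inferInstanceAs (Ring (RingQuot (EnvelopingRel k A L)))

noncomputable instance : Algebra k (Enveloping k A L) :=
  inferInstanceAs (Algebra k (RingQuot (EnvelopingRel k A L)))

/-- The quotient map from the tensor algebra. -/
noncomputable def mk : TensorAlgebra k (A × L) →ₐ[k] Enveloping k A L :=
  RingQuot.mkAlgHom k (EnvelopingRel k A L)

variable {k A L} in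
theorem mk_eq {s t : TensorAlgebra k (A × L)} (h : EnvelopingRel k A L s t) :
    mk k A L s = mk k A L t :=
  RingQuot.mkAlgHom_rel k h

/-- The canonical morphism of algebras `A → 𝒰_A(L)`. -/
noncomputable def ιA : A →ₐ[k] Enveloping k A L :=
  AlgHom.ofLinearMap
    ((mk k A L).toLinearMap ∘ₗ TensorAlgebra.ι k ∘ₗ LinearMap.inl k A L)
    (by simpa using mk_eq (EnvelopingRel.one (k := k) (A := A) (L := L)))
    (fun a b => by simpa using mk_eq (EnvelopingRel.mul (k := k) (L := L) a b))

/-- The canonical map `L → 𝒰_A(L)`; it is a morphism of Lie algebras by `Enveloping.ιL_lie`. -/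
noncomputable def ιL : L →ₗ[k] Enveloping k A L :=
  (mk k A L).toLinearMap ∘ₗ TensorAlgebra.ι k ∘ₗ LinearMap.inr k A L

variable {A L}

theorem ιL_lie (x y : L) :
    ιL k A L ⁅x, y⁆ = ιL k A L x * ιL k A L y - ιL k A L y * ιL k A L x := by
  simpa [ιL] using mk_eq (EnvelopingRel.lie (k := k) (A := A) x y)

theorem ιL_smul (a : A) (x : L) : ιL k A L (a • x) = ιA k A L a * ιL k A L x := by
  simpa [ιL, ιA] using mk_eq (EnvelopingRel.smul (k := k) a x)

theorem ιL_mul_ιA (x : L) (a : A) :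
    ιL k A L x * ιA k A L a = ιA k A L a * ιL k A L x + ιA k A L ⁅x, a⁆ := by
  have h := mk_eq (EnvelopingRel.anchor (k := k) x a)
  rw [map_sub, map_mul, map_mul] at h
  exact (sub_eq_iff_eq_add'.mp h)

variable {k}

/-- The universal property of `𝒰_A(L)`: existence. -/
noncomputable def lift {B : Type*} [Ring B] [Algebra k B] (φ : A →ₐ[k] B) (ψ : L →ₗ[k] B)
    (hlie : ∀ x y, ψ ⁅x, y⁆ = ψ x * ψ y - ψ y * ψ x)
    (hsmul : ∀ (a : A) (x : L), ψ (a • x) = φ a * ψ x)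
    (hanchor : ∀ (x : L) (a : A), ψ x * φ a - φ a * ψ x = φ ⁅x, a⁆) :
    Enveloping k A L →ₐ[k] B :=
  RingQuot.liftAlgHom k
    ⟨TensorAlgebra.lift k (φ.toLinearMap.coprod ψ), by
      intro s t h
      cases h with
      | one => simp
      | mul a b => simp
      | lie x y => simp [hlie]
      | smul a x => simp [hsmul]
      | anchor x a => simp [hanchor]⟩

section lift

variable {B : Type*} [Ring B] [Algebra k B] (φ : A →ₐ[k] B) (ψ : L →ₗ[k] B)
    (hlie : ∀ x y, ψ ⁅x, y⁆ = ψ x * ψ y - ψ y * ψ x)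
    (hsmul : ∀ (a : A) (x : L), ψ (a • x) = φ a * ψ x)
    (hanchor : ∀ (x : L) (a : A), ψ x * φ a - φ a * ψ x = φ ⁅x, a⁆)

theorem lift_ιA (a : A) : lift φ ψ hlie hsmul hanchor (ιA k A L a) = φ a := by
  have : lift φ ψ hlie hsmul hanchor (mk k A L (TensorAlgebra.ι k (a, 0))) = φ a := by
    rw [lift, mk]
    erw [RingQuot.liftAlgHom_mkAlgHom_apply]
    simp
  exact this

theorem lift_ιL (x : L) : lift φ ψ hlie hsmul hanchor (ιL k A L x) = ψ x := by
  have : lift φ ψ hlie hsmul hanchor (mk k A L (TensorAlgebra.ι k (0, x))) = ψ x := by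
    rw [lift, mk]
    erw [RingQuot.liftAlgHom_mkAlgHom_apply]
    simp
  exact this

/-- The universal property of `𝒰_A(L)`: uniqueness. -/
theorem hom_ext {f g : Enveloping k A L →ₐ[k] B}
    (hA : ∀ a, f (ιA k A L a) = g (ιA k A L a)) (hL : ∀ x, f (ιL k A L x) = g (ιL k A L x)) :
    f = g := by
  refine RingQuot.ringQuot_ext' k f g ?_
  refine TensorAlgebra.hom_ext (LinearMap.prod_ext ?_ ?_)
  · ext a; exact hA a
  · ext x; exact hL x

end lift

/-- `𝒰_A(L)` is generated, as a left ideal containing `1`, by `A` and `L`. -/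
theorem induction {P : Enveloping k A L → Prop} (one : P 1)
    (add : ∀ u v, P u → P v → P (u + v))
    (mulA : ∀ a u, P u → P (ιA k A L a * u)) (mulL : ∀ x u, P u → P (ιL k A L x * u))
    (u : Enveloping k A L) : P u := by
  have hsm (r : k) (v : Enveloping k A L) (h : P v) : P (r • v) := by
    have := mulA (algebraMap k A r) v h
    rwa [AlgHom.commutes, ← Algebra.smul_def] at this
  let S : Subalgebra k (Enveloping k A L) :=
    { carrier := {u | ∀ v, P v → P (u * v)}
      mul_mem' := fun {a b} ha hb v hv => by rw [mul_assoc]; exact ha _ (hb _ hv)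
      add_mem' := fun {a b} ha hb v hv => by rw [add_mul]; exact add _ _ (ha _ hv) (hb _ hv)
      algebraMap_mem' := fun r v hv => by rw [← Algebra.smul_def]; exact hsm _ _ hv }
  let φ : A →ₐ[k] S := (ιA k A L).codRestrict S (fun a v hv => mulA a v hv)
  let ψ : L →ₗ[k] S := (ιL k A L).codRestrict (Subalgebra.toSubmodule S) (fun x v hv => mulL x v hv)
  have key : S.val.comp (lift φ ψ
      (fun x y => Subtype.ext (ιL_lie k x y)) (fun a x => Subtype.ext (ιL_smul k a x))
      (fun x a => Subtype.ext (sub_eq_iff_eq_add'.mpr (ιL_mul_ιA k x a)))) = AlgHom.id k _ := by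
    apply hom_ext
    · intro a; rw [AlgHom.comp_apply, lift_ιA]; rfl
    · intro a; rw [AlgHom.comp_apply, lift_ιL]; rfl
  have hu : u ∈ S := by
    have := congrArg (fun f => f u) key
    simp only [AlgHom.comp_apply, AlgHom.id_apply] at this
    rw [← this]; exact Subtype.prop _
  simpa using hu 1 one


/-! ### The coalgebra structure over `A` -/

/-- The left `A`-module structure `a • u = ι(a) u`. -/
noncomputable instance : Module A (Enveloping k A L) :=
  Module.compHom _ (ιA k A L).toRingHom

theorem smul_def (a : A) (u : Enveloping k A L) : a • u = ιA k A L a * u := rfl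

instance : IsScalarTower k A (Enveloping k A L) :=
  ⟨fun r a u => by rw [smul_def, smul_def, map_smul, smul_mul_assoc]⟩

/-- Given `k`-linear operators `D` on `M` and `E` on `N` which satisfy the Leibniz rule
`D(a m) = a D(m) + δ(a) m` with the same `δ : A → A`, this is the operator `D ⊗ 1 + 1 ⊗ E` on
`M ⊗_A N`. -/
noncomputable def leibnizTensor {M N : Type*} [AddCommGroup M] [Module k M] [Module A M]
    [IsScalarTower k A M] [AddCommGroup N] [Module k N] [Module A N] [IsScalarTower k A N]
    (δ : A → A) (D : M →ₗ[k] M) (hD : ∀ (a : A) m, D (a • m) = a • D m + δ a • m)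
    (E : N →ₗ[k] N) (hE : ∀ (a : A) n, E (a • n) = a • E n + δ a • n) :
    M ⊗[A] N →ₗ[k] M ⊗[A] N where
  toFun := TensorProduct.liftAddHom
    (AddMonoidHom.mk' (fun m => AddMonoidHom.mk' (fun n => D m ⊗ₜ[A] n + m ⊗ₜ[A] E n)
      (fun n n' => by simp only [TensorProduct.tmul_add, map_add]; abel))
      (fun m m' => by
        ext n
        simp only [TensorProduct.add_tmul, map_add, AddMonoidHom.mk'_apply,
          AddMonoidHom.add_apply]
        abel))
    (fun a m n => by
      simp only [AddMonoidHom.mk'_apply, hD, hE, TensorProduct.add_tmul, TensorProduct.tmul_add,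
        TensorProduct.smul_tmul]
      abel)
  map_add' := map_add _
  map_smul' := fun r z => by
    induction z with
    | zero => simp
    | add x y hx hy =>
      simp only [smul_add, map_add, hx, hy]
    | tmul m n =>
      simp [TensorProduct.smul_tmul']

theorem leibnizTensor_tmul {M N : Type*} [AddCommGroup M] [Module k M] [Module A M]
    [IsScalarTower k A M] [AddCommGroup N] [Module k N] [Module A N] [IsScalarTower k A N]
    (δ : A → A) (D : M →ₗ[k] M) (hD : ∀ (a : A) m, D (a • m) = a • D m + δ a • m)
    (E : N →ₗ[k] N) (hE : ∀ (a : A) n, E (a • n) = a • E n + δ a • n) (m : M) (n : N) :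
    leibnizTensor δ D hD E hE (m ⊗ₜ[A] n) = D m ⊗ₜ[A] n + m ⊗ₜ[A] E n := rfl

theorem leibnizTensor_smul {M N : Type*} [AddCommGroup M] [Module k M] [Module A M]
    [IsScalarTower k A M] [AddCommGroup N] [Module k N] [Module A N] [IsScalarTower k A N]
    (δ : A → A) (D : M →ₗ[k] M) (hD : ∀ (a : A) m, D (a • m) = a • D m + δ a • m)
    (E : N →ₗ[k] N) (hE : ∀ (a : A) n, E (a • n) = a • E n + δ a • n) (a : A) (z : M ⊗[A] N) :
    leibnizTensor δ D hD E hE (a • z)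
      = a • leibnizTensor δ D hD E hE z + δ a • z := by
  induction z with
  | zero => simp
  | add x y hx hy => simp only [smul_add, map_add, hx, hy]; abel
  | tmul m n =>
    rw [TensorProduct.smul_tmul', leibnizTensor_tmul, leibnizTensor_tmul, hD]
    simp only [TensorProduct.add_tmul, TensorProduct.smul_tmul', smul_add]
    abel

theorem ιL_mul_smul (x : L) (a : A) (u : Enveloping k A L) :
    LinearMap.mulLeft k (ιL k A L x) (a • u)
      = a • LinearMap.mulLeft k (ιL k A L x) u + ⁅x, a⁆ • u := by
  simp only [LinearMap.mulLeft_apply, smul_def]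
  rw [← mul_assoc, ιL_mul_ιA, add_mul, mul_assoc]

/-- The action of `x ∈ L` on `𝒰_A(L) ⊗_A 𝒰_A(L)`, namely `ι(x) ⊗ 1 + 1 ⊗ ι(x)`. -/
noncomputable def diagL (x : L) :
    Module.End k (Enveloping k A L ⊗[A] Enveloping k A L) :=
  leibnizTensor (fun a => ⁅x, a⁆) (LinearMap.mulLeft k (ιL k A L x)) (ιL_mul_smul x)
    (LinearMap.mulLeft k (ιL k A L x)) (ιL_mul_smul x)

theorem diagL_tmul (x : L) (u v : Enveloping k A L) :
    diagL x (u ⊗ₜ[A] v) = (ιL k A L x * u) ⊗ₜ[A] v + u ⊗ₜ[A] (ιL k A L x * v) := rfl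

theorem diagL_smul (x : L) (a : A) (z : Enveloping k A L ⊗[A] Enveloping k A L) :
    diagL x (a • z) = a • diagL x z + ⁅x, a⁆ • z := leibnizTensor_smul ..

variable (k A L) in
/-- The action of `𝒰_A(L)` on `𝒰_A(L) ⊗_A 𝒰_A(L)`: an element `a ∈ A` acts by scalar
multiplication and `x ∈ L` by `ι(x) ⊗ 1 + 1 ⊗ ι(x)`. -/
noncomputable def diag :
    Enveloping k A L →ₐ[k] Module.End k (Enveloping k A L ⊗[A] Enveloping k A L) :=
  lift (Algebra.lsmul k k _)
    { toFun := diagL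
      map_add' := fun x y => by
        refine LinearMap.ext fun z => ?_
        induction z with
        | zero => simp
        | add z w hz hw => simp only [map_add, hz, hw]
        | tmul u v =>
          simp only [LinearMap.add_apply, diagL_tmul, map_add, add_mul, TensorProduct.add_tmul,
            TensorProduct.tmul_add]
          abel
      map_smul' := fun r x => by
        refine LinearMap.ext fun z => ?_
        induction z with
        | zero => simp
        | add z w hz hw => simp only [map_add, hz, hw]
        | tmul u v =>
          simp [diagL_tmul, TensorProduct.smul_tmul'] }
    (fun x y => by
      refine LinearMap.ext fun z => ?_
      induction z with
      | zero => simp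
      | add z w hz hw => simp only [map_add, hz, hw]
      | tmul u v =>
        simp only [LinearMap.coe_mk, AddHom.coe_mk, LinearMap.sub_apply, Module.End.mul_apply,
          diagL_tmul, map_add, ιL_lie, sub_mul, TensorProduct.sub_tmul, TensorProduct.tmul_sub,
          mul_assoc]
        abel)
    (fun a x => by
      refine LinearMap.ext fun z => ?_
      induction z with
      | zero => simp
      | add z w hz hw => simp only [map_add, hz, hw]
      | tmul u v =>
        simp only [LinearMap.coe_mk, AddHom.coe_mk, Module.End.mul_apply, Algebra.lsmul_coe,
          diagL_tmul, ιL_smul, mul_assoc, smul_add]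
        simp only [← smul_def, TensorProduct.smul_tmul', TensorProduct.tmul_smul])
    (fun x a => by
      refine LinearMap.ext fun z => ?_
      simp [diagL_smul])

theorem diag_ιA (a : A) (z : Enveloping k A L ⊗[A] Enveloping k A L) :
    diag k A L (ιA k A L a) z = a • z := by
  rw [diag, lift_ιA]; rfl

theorem diag_ιL (x : L) (z : Enveloping k A L ⊗[A] Enveloping k A L) :
    diag k A L (ιL k A L x) z = diagL x z := by
  rw [diag, lift_ιL]; rfl

variable (k A L) in
/-- The action of `𝒰_A(L)` on `A`: an element of `A` acts by multiplication and an element of `L`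
by the anchor. -/
noncomputable def act : Enveloping k A L →ₐ[k] Module.End k A :=
  lift (Algebra.lmul k A)
    { toFun := fun x => (LieRinehartAlgebra.anchor k A L x).toLinearMap
      map_add' := fun x y => by ext a; simp
      map_smul' := fun r x => by ext a; simp }
    (fun x y => LinearMap.ext fun a => lie_lie x y a)
    (fun a x => by ext b; simp)
    (fun x a => by ext b; simp [mul_comm])

theorem act_ιA (a b : A) : act k A L (ιA k A L a) b = a * b := by
  rw [act, lift_ιA]; rfl

theorem act_ιL (x : L) (b : A) : act k A L (ιL k A L x) b = ⁅x, b⁆ := by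
  rw [act, lift_ιL]; rfl

/-- The comultiplication `Δ(u) = u · (1 ⊗ 1)` and the counit `ε(u) = u · 1`; that is, the maps with
`Δ(1) = 1 ⊗ 1`, `Δ(ι(a) u) = a Δ(u)`, `Δ(ι(x) u) = (ι(x) ⊗ 1 + 1 ⊗ ι(x)) Δ(u)`, `ε(1) = 1`,
`ε(ι(a) u) = a ε(u)` and `ε(ι(x) u) = x(ε(u))`. -/
noncomputable instance : CoalgebraStruct A (Enveloping k A L) where
  comul :=
    { toFun := fun u => diag k A L u (1 ⊗ₜ 1)
      map_add' := fun u v => by simp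
      map_smul' := fun a u => by simp [smul_def, diag_ιA] }
  counit :=
    { toFun := fun u => act k A L u 1
      map_add' := fun u v => by simp
      map_smul' := fun a u => by simp [smul_def, act_ιA] }

open CoalgebraStruct

theorem comul_one : comul (R := A) (1 : Enveloping k A L) = 1 ⊗ₜ 1 := by
  change diag k A L 1 (1 ⊗ₜ 1) = _
  simp

theorem comul_ιL_mul (x : L) (u : Enveloping k A L) :
    comul (R := A) (ιL k A L x * u) = diagL x (comul (R := A) u) := by
  change diag k A L _ (1 ⊗ₜ 1) = diagL x (diag k A L _ (1 ⊗ₜ 1))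
  rw [map_mul, Module.End.mul_apply, diag_ιL]

theorem counit_one : counit (R := A) (1 : Enveloping k A L) = 1 := by
  change act k A L 1 1 = _
  simp

theorem counit_ιL_mul (x : L) (u : Enveloping k A L) :
    counit (R := A) (ιL k A L x * u) = ⁅x, counit (R := A) u⁆ := by
  change act k A L _ 1 = ⁅x, act k A L _ 1⁆
  rw [map_mul, Module.End.mul_apply, act_ιL]

/-- `𝒰_A(L)` is a coalgebra over `A`. -/
noncomputable instance : Coalgebra A (Enveloping k A L) where
  coassoc := by
    refine LinearMap.ext fun u => ?_
    simp only [LinearMap.comp_apply, LinearEquiv.coe_coe]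
    induction u using Enveloping.induction with
    | one => simp [comul_one]
    | add u v hu hv => simp only [map_add, hu, hv]
    | mulA a u hu => simp only [← smul_def, map_smul, hu]
    | mulL x u hu =>
      rw [comul_ιL_mul]
      let T := leibnizTensor (k := k) (A := A) (fun a => ⁅x, a⁆) (LinearMap.mulLeft k (ιL k A L x)) (ιL_mul_smul x)
        (diagL (k := k) (A := A) x) (diagL_smul x)
      have h1 : ∀ z, TensorProduct.assoc A _ _ _
          (LinearMap.rTensor (Enveloping k A L) (comul (R := A)) (diagL x z)) =
          T (TensorProduct.assoc A _ _ _
          (LinearMap.rTensor (Enveloping k A L) (comul (R := A)) z)) := by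
        intro z
        induction z with
        | zero => simp
        | add z w hz hw => simp only [map_add, hz, hw]
        | tmul v w =>
          simp only [diagL_tmul, map_add, LinearMap.rTensor_tmul, comul_ιL_mul]
          generalize (comul (R := A) v) = c
          induction c with
          | zero => simp
          | add c d hc hd =>
            simp only [map_add, TensorProduct.add_tmul, ← hc, ← hd]; abel
          | tmul p q =>
            simp only [T, diagL_tmul, TensorProduct.add_tmul, map_add, TensorProduct.assoc_tmul,
              leibnizTensor_tmul, LinearMap.mulLeft_apply, TensorProduct.tmul_add]
            abel
      have h2 : ∀ z, LinearMap.lTensor (Enveloping k A L) (comul (R := A)) (diagL x z) =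
          T (LinearMap.lTensor (Enveloping k A L) (comul (R := A)) z) := by
        intro z
        induction z with
        | zero => simp
        | add z w hz hw => simp only [map_add, hz, hw]
        | tmul v w =>
          simp only [T, diagL_tmul, map_add, LinearMap.lTensor_tmul, comul_ιL_mul,
            leibnizTensor_tmul, LinearMap.mulLeft_apply]
      rw [h1, h2, hu]
  rTensor_counit_comp_comul := by
    refine LinearMap.ext fun u => ?_
    simp only [LinearMap.comp_apply, TensorProduct.mk_apply]
    induction u using Enveloping.induction with
    | one => simp [comul_one, counit_one]
    | add u v hu hv => simp only [map_add, hu, hv, TensorProduct.tmul_add]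
    | mulA a u hu => simp only [← smul_def, map_smul, hu, TensorProduct.tmul_smul]
    | mulL x u hu =>
      apply (TensorProduct.lid A (Enveloping k A L)).injective
      have h1 : ∀ z : Enveloping k A L ⊗[A] Enveloping k A L,
          TensorProduct.lid A _ (LinearMap.rTensor _ (counit (R := A)) (diagL x z)) =
          ιL k A L x * TensorProduct.lid A _ (LinearMap.rTensor _ (counit (R := A)) z) := by
        intro z
        induction z with
        | zero => simp
        | add z w hz hw => simp only [map_add, hz, hw, mul_add]
        | tmul v w =>
          simp only [diagL_tmul, map_add, LinearMap.rTensor_tmul, counit_ιL_mul,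
            TensorProduct.lid_tmul, smul_def]
          rw [← mul_assoc (ιL k A L x), ιL_mul_ιA, add_mul, mul_assoc]
          abel
      rw [comul_ιL_mul, h1, hu]
      simp
  lTensor_counit_comp_comul := by
    refine LinearMap.ext fun u => ?_
    simp only [LinearMap.comp_apply, LinearMap.flip_apply, TensorProduct.mk_apply]
    induction u using Enveloping.induction with
    | one => simp [comul_one, counit_one]
    | add u v hu hv => simp only [map_add, hu, hv, TensorProduct.add_tmul]
    | mulA a u hu =>
      simp only [← smul_def, map_smul, hu, TensorProduct.smul_tmul']
    | mulL x u hu =>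
      apply (TensorProduct.rid A (Enveloping k A L)).injective
      have h1 : ∀ z : Enveloping k A L ⊗[A] Enveloping k A L,
          TensorProduct.rid A _ (LinearMap.lTensor _ (counit (R := A)) (diagL x z)) =
          ιL k A L x * TensorProduct.rid A _ (LinearMap.lTensor _ (counit (R := A)) z) := by
        intro z
        induction z with
        | zero => simp
        | add z w hz hw => simp only [map_add, hz, hw, mul_add]
        | tmul v w =>
          simp only [diagL_tmul, map_add, LinearMap.lTensor_tmul, counit_ιL_mul,
            TensorProduct.rid_tmul, smul_def]
          rw [← mul_assoc (ιL k A L x), ιL_mul_ιA, add_mul, mul_assoc]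
      rw [comul_ιL_mul, h1, hu]
      simp

end Enveloping
end Enveloping

/-! ### Module algebras over a bialgebra and smash products -/

section Smash

/-- A left module algebra `R` over a `k`-bialgebra `H`: a left `H`-module structure on `R` with
`h · (a b) = ∑ (h₁ · a) (h₂ · b)` and `h · 1 = ε(h) 1`. -/
structure ModuleAlgebra (k H R : Type*) [CommRing k] [Ring H] [Bialgebra k H] [CommRing R]
    [Algebra k R] where
  /-- The module structure. -/
  act : H →ₐ[k] Module.End k R
  act_mul : ∀ (h : H) (a b : R), act h (a * b) =
    LinearMap.mul' k R (TensorProduct.map (act.toLinearMap.flip a) (act.toLinearMap.flip b)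
      (Coalgebra.comul h))
  act_one : ∀ h : H, act h 1 = algebraMap k R (Coalgebra.counit h)

variable {k H R : Type*} [CommRing k] [Ring H] [Bialgebra k H] [CommRing R] [Algebra k R]

namespace ModuleAlgebra

variable (M : ModuleAlgebra k H R)

/-- The action of `H` on `R ⊗ H` given by `h · (r ⊗ u) = ∑ (h₁ · r) ⊗ h₂ u`. -/
noncomputable def diag : H →ₐ[k] Module.End k (R ⊗[k] H) :=
  (Module.endTensorEndAlgHom (R := k) (S := k) (A := k)).comp
    ((Algebra.TensorProduct.map M.act (Algebra.lmul k H)).comp (Bialgebra.comulAlgHom k H))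

theorem diag_tmul (h : H) (r : R) (u : H) :
    M.diag h (r ⊗ₜ u) =
      TensorProduct.map (M.act.toLinearMap.flip r) (LinearMap.mulRight k u)
        (Coalgebra.comul h) := by
  simp only [diag, AlgHom.comp_apply, Bialgebra.comulAlgHom_apply]
  generalize (Coalgebra.comul (R := k) h) = c
  induction c with
  | zero => simp
  | add c d hc hd => simp only [map_add, LinearMap.add_apply, hc, hd]
  | tmul p q => simp [Module.endTensorEndAlgHom_apply]

end ModuleAlgebra

/-- The smash product `R # H`, with underlying space `R ⊗ H`. -/
def SmashProduct (_M : ModuleAlgebra k H R) : Type _ := R ⊗[k] H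

namespace SmashProduct

variable (M : ModuleAlgebra k H R)

noncomputable instance : AddCommGroup (SmashProduct M) :=
  inferInstanceAs (AddCommGroup (R ⊗[k] H))

noncomputable instance : Module k (SmashProduct M) :=
  inferInstanceAs (Module k (R ⊗[k] H))

/-- The left `R`-module structure `a • (r # u) = (a r) # u`. -/
noncomputable instance : Module R (SmashProduct M) :=
  inferInstanceAs (Module R (R ⊗[k] H))

instance : IsScalarTower k R (SmashProduct M) :=
  inferInstanceAs (IsScalarTower k R (R ⊗[k] H))

/-- The coalgebra structure over `R` on `R # H = R ⊗ H` obtained from that of `H` by extension of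
scalars. -/
noncomputable instance : Coalgebra R (SmashProduct M) :=
  inferInstanceAs (Coalgebra R (R ⊗[k] H))

variable {M} in
/-- The element `r # u`. -/
noncomputable def tmul (r : R) (u : H) : SmashProduct M := (r ⊗ₜ[k] u : R ⊗[k] H)

/-- The comultiplication is `Δ(r # u) = ∑ (r # u₁) ⊗ (1 # u₂)`. -/
theorem comul_tmul (r : R) (u : H) {ι : Type*} (c : Coalgebra.Repr k u ι) :
    Coalgebra.comul (R := R) (tmul r u : SmashProduct M)
      = ∑ i ∈ c.index, (tmul r (c.left i) : SmashProduct M) ⊗ₜ[R] tmul 1 (c.right i) := by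
  change Coalgebra.comul (R := R) (r ⊗ₜ[k] u : R ⊗[k] H) = ∑ i ∈ c.index,
    ((r ⊗ₜ[k] c.left i : R ⊗[k] H) ⊗ₜ[R] (1 ⊗ₜ[k] c.right i : R ⊗[k] H))
  rw [TensorProduct.comul_tmul, ← c.eq]
  have hr (v : H) : (r ⊗ₜ[k] v : R ⊗[k] H) = r • (1 ⊗ₜ[k] v : R ⊗[k] H) := by
    simp [TensorProduct.smul_tmul']
  simp only [CommSemiring.comul_apply, TensorProduct.tmul_sum, map_sum,
    TensorProduct.AlgebraTensorModule.tensorTensorTensorComm_tmul]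
  refine Finset.sum_congr rfl fun i _ => ?_
  rw [hr, hr (c.left i), TensorProduct.smul_tmul]

/-- The counit is `ε(r # u) = r ε(u)`. -/
theorem counit_tmul (r : R) (u : H) :
    Coalgebra.counit (R := R) (tmul r u : SmashProduct M)
      = r * algebraMap k R (Coalgebra.counit u) := by
  change Coalgebra.counit (R := R) (r ⊗ₜ[k] u : R ⊗[k] H) = _
  simp [TensorProduct.counit_tmul, Algebra.smul_def, mul_comm]

/-- Left multiplication in the smash product: `r # h` acts on `R ⊗ H` as the action of `h`
followed by multiplication with `r ⊗ 1`. -/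
noncomputable def mulMap : R ⊗[k] H →ₗ[k] Module.End k (R ⊗[k] H) :=
  TensorProduct.lift
    ((LinearMap.mul k (Module.End k (R ⊗[k] H))).compl₁₂
      (Algebra.lsmul k k (R ⊗[k] H) : R →ₐ[k] _).toLinearMap M.diag.toLinearMap)

theorem mulMap_tmul (r : R) (h : H) (z : R ⊗[k] H) :
    mulMap M (r ⊗ₜ h) z = r • M.diag h z := by
  simp [mulMap]

theorem mulMap_tmul_tmul (r s : R) (u v : H) {ι : Type*} (c : Coalgebra.Repr k u ι) :
    mulMap M (r ⊗ₜ u) (s ⊗ₜ v) =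
      ∑ i ∈ c.index, (r * M.act (c.left i) s) ⊗ₜ[k] (c.right i * v) := by
  rw [mulMap_tmul, M.diag_tmul, ← c.eq]
  simp [Finset.smul_sum, TensorProduct.smul_tmul']

theorem diag_smul (h : H) (s : R) (z : R ⊗[k] H) :
    M.diag h (s • z) = mulMap M (TensorProduct.map (M.act.toLinearMap.flip s) LinearMap.id
      (Coalgebra.comul h)) z := by
  induction z with
  | zero => simp
  | add z w hz hw => simp only [smul_add, map_add, hz, hw]
  | tmul t w =>
    let c := Coalgebra.Repr.arbitrary k h
    let c₁ := fun i => Coalgebra.Repr.arbitrary k (c.left i)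
    let c₂ := fun i => Coalgebra.Repr.arbitrary k (c.right i)
    let G : H ⊗[k] (H ⊗[k] H) →ₗ[k] R ⊗[k] H :=
      LinearMap.rTensor H (LinearMap.mul' k R) ∘ₗ
        (TensorProduct.assoc k R R H).symm.toLinearMap ∘ₗ
        TensorProduct.map (M.act.toLinearMap.flip s)
          (TensorProduct.map (M.act.toLinearMap.flip t) (LinearMap.mulRight k w))
    have key := congrArg G (Coalgebra.sum_tmul_tmul_eq c c₁ c₂)
    simp only [G, map_sum, LinearMap.comp_apply, TensorProduct.map_tmul,
      LinearEquiv.coe_coe, TensorProduct.assoc_symm_tmul, LinearMap.rTensor_tmul,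
      LinearMap.mul'_apply, LinearMap.flip_apply, LinearMap.mulRight_apply,
      AlgHom.toLinearMap_apply] at key
    have e1 : M.diag h (s • (t ⊗ₜ[k] w)) = ∑ i ∈ c.index, ∑ j ∈ (c₁ i).index,
        (M.act ((c₁ i).left j) s * M.act ((c₁ i).right j) t) ⊗ₜ[k] (c.right i * w) := by
      rw [TensorProduct.smul_tmul', smul_eq_mul, M.diag_tmul, ← c.eq]
      simp only [map_sum, TensorProduct.map_tmul, LinearMap.flip_apply,
        AlgHom.toLinearMap_apply, LinearMap.mulRight_apply]
      refine Finset.sum_congr rfl fun i _ => ?_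
      rw [M.act_mul, ← (c₁ i).eq]
      simp [TensorProduct.sum_tmul]
    have e2 : mulMap M (TensorProduct.map (M.act.toLinearMap.flip s) LinearMap.id
        (Coalgebra.comul h)) (t ⊗ₜ[k] w) = ∑ i ∈ c.index, ∑ j ∈ (c₂ i).index,
        (M.act (c.left i) s * M.act ((c₂ i).left j) t) ⊗ₜ[k] ((c₂ i).right j * w) := by
      conv_lhs => rw [← c.eq]
      simp only [map_sum, TensorProduct.map_tmul, LinearMap.flip_apply,
        AlgHom.toLinearMap_apply, LinearMap.id_apply, LinearMap.sum_apply]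
      exact Finset.sum_congr rfl fun i _ => mulMap_tmul_tmul M _ _ _ _ (c₂ i)
    rw [e1, e2, key]

theorem mulMap_assoc (x y z : R ⊗[k] H) :
    mulMap M (mulMap M x y) z = mulMap M x (mulMap M y z) := by
  induction x with
  | zero => simp
  | add x x' hx hx' => simp only [map_add, LinearMap.add_apply, hx, hx']
  | tmul r u =>
    induction y with
    | zero => simp
    | add x x' hx hx' => simp only [map_add, LinearMap.add_apply, hx, hx']
    | tmul s v =>
      rw [mulMap_tmul, mulMap_tmul, mulMap_tmul, diag_smul, M.diag_tmul]
      generalize (Coalgebra.comul (R := k) u) = c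
      induction c with
      | zero => simp
      | add c d hc hd => simp only [map_add, smul_add, LinearMap.add_apply, hc, hd]
      | tmul p q =>
        simp [TensorProduct.smul_tmul', mulMap_tmul, mul_smul]

theorem mulMap_one_right (x : R ⊗[k] H) : mulMap M x (1 ⊗ₜ 1) = x := by
  induction x with
  | zero => simp
  | add x y hx hy => simp only [map_add, LinearMap.add_apply, hx, hy]
  | tmul r h =>
    let c := Coalgebra.Repr.arbitrary k h
    have key := congrArg (LinearMap.rTensor H (Algebra.linearMap k R))
      (Coalgebra.sum_counit_tmul_eq c)
    simp only [map_sum, LinearMap.rTensor_tmul, Algebra.linearMap_apply, map_one] at key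
    rw [mulMap_tmul, M.diag_tmul, ← c.eq]
    simp only [map_sum, TensorProduct.map_tmul, LinearMap.flip_apply,
      AlgHom.toLinearMap_apply, LinearMap.mulRight_apply, mul_one, M.act_one, key]
    simp [TensorProduct.smul_tmul']

theorem mulMap_one_left (x : R ⊗[k] H) : mulMap M (1 ⊗ₜ 1) x = x := by
  rw [mulMap_tmul]; simp

noncomputable instance : Ring (SmashProduct M) :=
  { (inferInstance : AddCommGroup (SmashProduct M)) with
    mul := fun x y => mulMap M x y
    one := (1 ⊗ₜ 1 : R ⊗[k] H)
    mul_assoc := mulMap_assoc M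
    left_distrib := fun x y z => map_add (mulMap M x) y z
    right_distrib := fun x y z => LinearMap.congr_fun (map_add (mulMap M) x y) z
    zero_mul := fun x => LinearMap.congr_fun (map_zero (mulMap M)) x
    mul_zero := fun x => map_zero (mulMap M x)
    one_mul := mulMap_one_left M
    mul_one := mulMap_one_right M }

theorem mul_def (x y : SmashProduct M) : x * y = mulMap M x y := rfl

theorem one_def : (1 : SmashProduct M) = tmul 1 1 := rfl

/-- The multiplication is `(r # u) (s # v) = ∑ r (u₁ · s) # u₂ v`. -/
theorem tmul_mul_tmul (r s : R) (u v : H) {ι : Type*} (c : Coalgebra.Repr k u ι) :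
    (tmul r u * tmul s v : SmashProduct M) =
      ∑ i ∈ c.index, tmul (r * M.act (c.left i) s) (c.right i * v) :=
  mulMap_tmul_tmul M r s u v c

noncomputable instance : Algebra k (SmashProduct M) :=
  Algebra.ofModule
    (fun r x y => LinearMap.congr_fun (map_smul (mulMap M) r x) y)
    (fun r x y => map_smul (mulMap M x) r y)

end SmashProduct
end Smash

/-! ### The enveloping algebra of a Lie algebra as a bialgebra -/

section LieAlgebra

variable (k : Type*) {h : Type*} [CommRing k] [LieRing h] [LieAlgebra k h]

section Bialgebra

attribute [local instance 100] LieRing.ofAssociativeRing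

theorem uea_hom_ext {B : Type*} [Ring B] [Algebra k B] {f g : UniversalEnvelopingAlgebra k h →ₐ[k] B}
    (hfg : ∀ x, f (UniversalEnvelopingAlgebra.ι k x) = g (UniversalEnvelopingAlgebra.ι k x)) :
    f = g :=
  UniversalEnvelopingAlgebra.hom_ext k (LieHom.ext hfg)

theorem uea_induction {P : UniversalEnvelopingAlgebra k h → Prop}
    (algebraMap : ∀ r : k, P (algebraMap k _ r)) (add : ∀ u v, P u → P v → P (u + v))
    (mul : ∀ u v, P u → P v → P (u * v)) (ι : ∀ x, P (UniversalEnvelopingAlgebra.ι k x))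
    (u : UniversalEnvelopingAlgebra k h) : P u := by
  let S : Subalgebra k (UniversalEnvelopingAlgebra k h) :=
    { carrier := {u | P u}
      mul_mem' := fun {a b} ha hb => mul a b ha hb
      add_mem' := fun {a b} ha hb => add a b ha hb
      algebraMap_mem' := algebraMap }
  let φ : h →ₗ⁅k⁆ S :=
    { toFun := fun x => ⟨UniversalEnvelopingAlgebra.ι k x, ι x⟩
      map_add' := fun x y => Subtype.ext (map_add (UniversalEnvelopingAlgebra.ι k) x y)
      map_smul' := fun r x => Subtype.ext (map_smul (UniversalEnvelopingAlgebra.ι k) r x)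
      map_lie' := fun {x y} => Subtype.ext (LieHom.map_lie (UniversalEnvelopingAlgebra.ι k) x y) }
  have key : S.val.comp (UniversalEnvelopingAlgebra.lift k φ) = AlgHom.id k _ := by
    refine uea_hom_ext k fun x => ?_
    rw [AlgHom.comp_apply, UniversalEnvelopingAlgebra.lift_ι_apply]
    rfl
  have := congrArg (fun f => f u) key
  simp only [AlgHom.comp_apply, AlgHom.id_apply] at this
  rw [← this]; exact Subtype.prop _

/-- The comultiplication of `U(h)`, determined by `Δ(x) = x ⊗ 1 + 1 ⊗ x` for `x ∈ h`. -/
noncomputable def ueaComul : UniversalEnvelopingAlgebra k h →ₐ[k]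
    UniversalEnvelopingAlgebra k h ⊗[k] UniversalEnvelopingAlgebra k h :=
  UniversalEnvelopingAlgebra.lift k
    { toFun := fun x => UniversalEnvelopingAlgebra.ι k x ⊗ₜ 1 + 1 ⊗ₜ UniversalEnvelopingAlgebra.ι k x
      map_add' := fun x y => by
        simp only [map_add, TensorProduct.add_tmul, TensorProduct.tmul_add]; abel
      map_smul' := fun r x => by
        simp [TensorProduct.smul_tmul']
      map_lie' := fun {x y} => by
        simp only [LieHom.map_lie, LieRing.of_associative_ring_bracket, mul_add, add_mul,
          Algebra.TensorProduct.tmul_mul_tmul, one_mul, mul_one, TensorProduct.sub_tmul,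
          TensorProduct.tmul_sub]
        abel }

/-- The counit of `U(h)`, determined by `ε(x) = 0` for `x ∈ h`. -/
noncomputable def ueaCounit : UniversalEnvelopingAlgebra k h →ₐ[k] k :=
  UniversalEnvelopingAlgebra.lift k 0

theorem ueaComul_ι (x : h) : ueaComul k (UniversalEnvelopingAlgebra.ι k x) =
    UniversalEnvelopingAlgebra.ι k x ⊗ₜ 1 + 1 ⊗ₜ UniversalEnvelopingAlgebra.ι k x :=
  UniversalEnvelopingAlgebra.lift_ι_apply ..

theorem ueaCounit_ι (x : h) : ueaCounit k (UniversalEnvelopingAlgebra.ι k x) = 0 :=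
  UniversalEnvelopingAlgebra.lift_ι_apply ..

noncomputable instance : Bialgebra k (UniversalEnvelopingAlgebra k h) :=
  Bialgebra.ofAlgHom (ueaComul k) (ueaCounit k)
    (by
      refine uea_hom_ext k fun x => ?_
      change Algebra.TensorProduct.assoc k k k _ _ _ (Algebra.TensorProduct.map _ _
        (ueaComul k (UniversalEnvelopingAlgebra.ι k x))) = Algebra.TensorProduct.map _ _
        (ueaComul k (UniversalEnvelopingAlgebra.ι k x))
      simp [-UniversalEnvelopingAlgebra.ι_apply, ueaComul_ι, TensorProduct.add_tmul, TensorProduct.tmul_add, add_assoc,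
        Algebra.TensorProduct.one_def])
    (by
      refine uea_hom_ext k fun x => ?_
      change Algebra.TensorProduct.map _ _
        (ueaComul k (UniversalEnvelopingAlgebra.ι k x)) =
        (Algebra.TensorProduct.lid k _).symm (UniversalEnvelopingAlgebra.ι k x)
      simp [-UniversalEnvelopingAlgebra.ι_apply, ueaComul_ι, ueaCounit_ι])
    (by
      refine uea_hom_ext k fun x => ?_
      change Algebra.TensorProduct.map _ _
        (ueaComul k (UniversalEnvelopingAlgebra.ι k x)) =
        (Algebra.TensorProduct.rid k k _).symm (UniversalEnvelopingAlgebra.ι k x)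
      simp [-UniversalEnvelopingAlgebra.ι_apply, ueaComul_ι, ueaCounit_ι])

variable {k} {A : Type*} [CommRing A] [Algebra k A]

/-- The action of `U(h)` on `A` which extends an action of `h` on `A`. -/
noncomputable def ueaAct (ρ : h →ₗ⁅k⁆ Derivation k A A) :
    UniversalEnvelopingAlgebra k h →ₐ[k] Module.End k A :=
  UniversalEnvelopingAlgebra.lift k
    { toFun := fun x => (ρ x).toLinearMap
      map_add' := fun x y => by ext a; simp
      map_smul' := fun r x => by ext a; simp
      map_lie' := fun {x y} => by
        ext a
        simp [LieRing.of_associative_ring_bracket] }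

theorem ueaAct_ι (ρ : h →ₗ⁅k⁆ Derivation k A A) (x : h) (a : A) :
    ueaAct ρ (UniversalEnvelopingAlgebra.ι k x) a = ρ x a := by
  rw [ueaAct, UniversalEnvelopingAlgebra.lift_ι_apply]; rfl

end Bialgebra

variable {k} {A : Type*} [CommRing A] [Algebra k A]

/-- A representation of the Lie algebra `h` on `A` by derivations makes `A` a module algebra over
`U(h)`. -/
noncomputable def ueaModuleAlgebra (ρ : h →ₗ⁅k⁆ Derivation k A A) :
    ModuleAlgebra k (UniversalEnvelopingAlgebra k h) A where
  act := ueaAct ρ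
  act_mul := by
    intro u
    change ∀ a b, _ = LinearMap.mul' k A (TensorProduct.map _ _ (ueaComul k u))
    induction u using uea_induction with
    | algebraMap r =>
      intro a b
      simp [Algebra.TensorProduct.algebraMap_apply]
    | add u v hu hv => intro a b; simp only [map_add, LinearMap.add_apply, hu, hv]
    | mul u v hu hv =>
      intro a b
      rw [map_mul (ueaAct ρ), map_mul (ueaComul k), Module.End.mul_apply, hv]
      generalize ueaComul k v = c
      induction c with
      | zero => simp
      | add c d hc hd => simp only [map_add, mul_add, hc, hd]
      | tmul p q =>
        rw [TensorProduct.map_tmul, LinearMap.mul'_apply, hu]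
        generalize ueaComul k u = c
        induction c with
        | zero => simp
        | add c d hc hd => simp only [map_add, add_mul, hc, hd]
        | tmul p q => simp
    | ι x =>
      intro a b
      simp [-UniversalEnvelopingAlgebra.ι_apply, ueaComul_ι, ueaAct_ι, mul_comm, add_comm]
  act_one := by
    intro u
    change _ = algebraMap k A (ueaCounit k u)
    induction u using uea_induction with
    | algebraMap r => simp [Algebra.smul_def]
    | add u v hu hv => simp only [map_add, LinearMap.add_apply, hu, hv]
    | mul u v hu hv =>
      rw [map_mul, Module.End.mul_apply, hv, Algebra.algebraMap_eq_smul_one, map_smul, hu]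
      simp [Algebra.smul_def, mul_comm]
    | ι x => simp [-UniversalEnvelopingAlgebra.ι_apply, ueaCounit_ι, ueaAct_ι]

/-! ### Transformation Lie-Rinehart algebras -/

/-- The underlying `A`-module `A ⊗ h` of the transformation Lie-Rinehart algebra `A ⋊ h` of a
representation `ρ` of `h` on `A` by derivations. -/
def Transformation (_ρ : h →ₗ⁅k⁆ Derivation k A A) : Type _ := A ⊗[k] h

namespace Transformation

variable (ρ : h →ₗ⁅k⁆ Derivation k A A)

noncomputable instance : AddCommGroup (Transformation ρ) :=
  inferInstanceAs (AddCommGroup (A ⊗[k] h))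

noncomputable instance : Module k (Transformation ρ) :=
  inferInstanceAs (Module k (A ⊗[k] h))

noncomputable instance : Module A (Transformation ρ) :=
  inferInstanceAs (Module A (A ⊗[k] h))

instance : IsScalarTower k A (Transformation ρ) :=
  inferInstanceAs (IsScalarTower k A (A ⊗[k] h))

variable {ρ} in
/-- The element `f ⊗ v` of `A ⋊ h`. -/
noncomputable def tmul (f : A) (v : h) : Transformation ρ := (f ⊗ₜ[k] v : A ⊗[k] h)

variable {ρ} in
theorem induction {P : Transformation ρ → Prop} (zero : P 0)
    (add : ∀ x y, P x → P y → P (x + y)) (tmul : ∀ f v, P (tmul f v)) (x : Transformation ρ) :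
    P x :=
  TensorProduct.induction_on (motive := fun x : A ⊗[k] h => P x) x zero tmul add

/-- The anchor `f ⊗ v ↦ f ρ(v)`. -/
noncomputable def anchor : Transformation ρ →ₗ[A] Derivation k A A :=
  TensorProduct.AlgebraTensorModule.lift
    ((LinearMap.lsmul A (Derivation k A A)).flip.restrictScalars k ∘ₗ (ρ : h →ₗ[k] _)).flip

theorem anchor_tmul (f : A) (v : h) : anchor ρ (tmul f v) = f • ρ v :=
  TensorProduct.AlgebraTensorModule.lift_tmul ..

/-- The `k`-bilinear map `(f ⊗ v, g ⊗ w) ↦ (f ρ(v)(g)) ⊗ w`. -/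
noncomputable def connection :
    Transformation ρ →ₗ[k] Transformation ρ →ₗ[k] Transformation ρ :=
  (LinearMap.rTensorHom (R := k) (N := A) (P := A) h) ∘ₗ
    { toFun := fun x => (anchor ρ x).toLinearMap
      map_add' := fun x y => by ext a; simp
      map_smul' := fun r x => by
        rw [← algebraMap_smul A r x, map_smul, algebraMap_smul]; rfl }

theorem connection_tmul (x : Transformation ρ) (g : A) (w : h) :
    connection ρ x (tmul g w) = tmul (anchor ρ x g) w := rfl

/-- The `k`-bilinear map `(f ⊗ v, g ⊗ w) ↦ (f g) ⊗ [v, w]`. -/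
noncomputable def linearBracket :
    Transformation ρ →ₗ[k] Transformation ρ →ₗ[k] Transformation ρ :=
  TensorProduct.map₂ (LinearMap.mul k A)
    (LinearMap.mk₂ k (fun v w : h => ⁅v, w⁆) add_lie smul_lie lie_add lie_smul)

/-- The bracket
`[f ⊗ v, g ⊗ w] = (f g) ⊗ [v, w] + (f ρ(v)(g)) ⊗ w - (g ρ(w)(f)) ⊗ v`. -/
noncomputable def bracket :
    Transformation ρ →ₗ[k] Transformation ρ →ₗ[k] Transformation ρ :=
  linearBracket ρ + connection ρ - (connection ρ).flip

noncomputable instance : Bracket (Transformation ρ) (Transformation ρ) :=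
  ⟨fun x y => bracket ρ x y⟩

theorem lie_tmul_tmul (f g : A) (v w : h) :
    ⁅(tmul f v : Transformation ρ), (tmul g w : Transformation ρ)⁆ =
      tmul (f * g) ⁅v, w⁆ + tmul (f * ρ v g) w - tmul (g * ρ w f) v := by
  change tmul (f * g) ⁅v, w⁆ + connection ρ (tmul f v) (tmul g w)
    - connection ρ (tmul g w) (tmul f v) = _
  rw [connection_tmul, connection_tmul, anchor_tmul, anchor_tmul]
  simp

theorem tmul_add (f : A) (v w : h) :
    (tmul f (v + w) : Transformation ρ) = tmul f v + tmul f w := TensorProduct.tmul_add f v w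

theorem tmul_sub (f : A) (v w : h) :
    (tmul f (v - w) : Transformation ρ) = tmul f v - tmul f w := TensorProduct.tmul_sub f v w

theorem add_tmul (f g : A) (v : h) :
    (tmul (f + g) v : Transformation ρ) = tmul f v + tmul g v := TensorProduct.add_tmul f g v

theorem sub_tmul (f g : A) (v : h) :
    (tmul (f - g) v : Transformation ρ) = tmul f v - tmul g v := TensorProduct.sub_tmul f g v

theorem smul_tmul (f g : A) (v : h) :
    (f • tmul g v : Transformation ρ) = tmul (f * g) v := rfl

theorem lie_add' (x y z : Transformation ρ) : ⁅x, y + z⁆ = ⁅x, y⁆ + ⁅x, z⁆ :=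
  map_add (bracket ρ x) y z

theorem add_lie' (x y z : Transformation ρ) : ⁅x + y, z⁆ = ⁅x, z⁆ + ⁅y, z⁆ :=
  LinearMap.congr_fun (map_add (bracket ρ) x y) z

theorem lie_sub' (x y z : Transformation ρ) : ⁅x, y - z⁆ = ⁅x, y⁆ - ⁅x, z⁆ :=
  map_sub (bracket ρ x) y z

theorem sub_lie' (x y z : Transformation ρ) : ⁅x - y, z⁆ = ⁅x, z⁆ - ⁅y, z⁆ :=
  LinearMap.congr_fun (map_sub (bracket ρ) x y) z

theorem lie_zero' (x : Transformation ρ) : ⁅x, (0 : Transformation ρ)⁆ = 0 :=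
  map_zero (bracket ρ x)

theorem zero_lie' (x : Transformation ρ) : ⁅(0 : Transformation ρ), x⁆ = 0 :=
  LinearMap.congr_fun (map_zero (bracket ρ)) x

theorem lie_skew_add (x y : Transformation ρ) : ⁅x, y⁆ + ⁅y, x⁆ = 0 := by
  induction x using Transformation.induction with
  | zero => rw [lie_zero', zero_lie', add_zero]
  | add x x' hx hx' =>
    rw [lie_add', add_lie', add_add_add_comm, hx, hx', add_zero]
  | tmul f v =>
    induction y using Transformation.induction with
    | zero => rw [lie_zero', zero_lie', add_zero]
    | add x x' hx hx' =>
      rw [lie_add', add_lie', add_add_add_comm, hx, hx', add_zero]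
    | tmul g w =>
      rw [lie_tmul_tmul, lie_tmul_tmul, mul_comm g f, ← lie_skew v w]
      have : (tmul (f * g) (-⁅w, v⁆) : Transformation ρ) = -tmul (f * g) ⁅w, v⁆ :=
        TensorProduct.tmul_neg ..
      rw [this]
      abel

theorem leibniz_tmul (f g e : A) (u v w : h) :
    ⁅(tmul f u : Transformation ρ), ⁅(tmul g v : Transformation ρ), (tmul e w : Transformation ρ)⁆⁆
     = ⁅⁅(tmul f u : Transformation ρ), (tmul g v : Transformation ρ)⁆, (tmul e w : Transformation ρ)⁆
     + ⁅(tmul g v : Transformation ρ), ⁅(tmul f u : Transformation ρ), (tmul e w : Transformation ρ)⁆⁆ := by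
  simp only [lie_tmul_tmul, lie_add', lie_sub', add_lie', sub_lie', leibniz_lie u v w,
    LieHom.map_lie, Derivation.commutator_apply, Derivation.leibniz, smul_eq_mul, tmul_add]
  have h1 : ⁅v, u⁆ = -⁅u, v⁆ := (lie_skew v u).symm
  have h2 (f : A) (v : h) : (tmul f (-v) : Transformation ρ) = -tmul f v :=
    TensorProduct.tmul_neg ..
  simp only [h1, h2, mul_add, mul_sub, add_tmul, sub_tmul, mul_assoc, mul_comm, mul_left_comm]
  abel

noncomputable instance : LieRing (Transformation ρ) where
  add_lie := add_lie' ρ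
  lie_add := lie_add' ρ
  lie_self x := by
    induction x using Transformation.induction with
    | zero => exact zero_lie' ρ 0
    | add x y hx hy =>
      rw [add_lie', lie_add', lie_add', hx, hy, zero_add, add_zero, lie_skew_add]
    | tmul f v =>
      rw [lie_tmul_tmul, lie_self]
      have : (tmul (f * f) 0 : Transformation ρ) = 0 := TensorProduct.tmul_zero ..
      rw [this]; abel
  leibniz_lie x y z := by
    induction x using Transformation.induction with
    | zero => simp only [zero_lie', lie_zero', add_zero]
    | add x x' hx hx' => simp only [add_lie', lie_add', hx, hx']; abel
    | tmul f u =>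
      induction y using Transformation.induction with
      | zero => simp only [zero_lie', lie_zero', add_zero]
      | add x x' hx hx' => simp only [add_lie', lie_add', hx, hx']; abel
      | tmul g v =>
        induction z using Transformation.induction with
        | zero => simp only [lie_zero', add_zero]
        | add x x' hx hx' => simp only [lie_add', hx, hx']; abel
        | tmul e w => exact leibniz_tmul ρ f g e u v w

noncomputable instance : LieAlgebra k (Transformation ρ) where
  lie_smul r x y := map_smul (bracket ρ x) r y

theorem anchor_lie (x y : Transformation ρ) :
    anchor ρ ⁅x, y⁆ = ⁅anchor ρ x, anchor ρ y⁆ := by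
  induction x using Transformation.induction with
  | zero => simp
  | add x x' hx hx' => simp only [add_lie, map_add, hx, hx']
  | tmul f v =>
    induction y using Transformation.induction with
    | zero => simp
    | add x x' hx hx' => simp only [lie_add, map_add, hx, hx']
    | tmul g w =>
      ext a
      simp only [lie_tmul_tmul, map_add, map_sub, anchor_tmul, LieHom.map_lie,
        Derivation.commutator_apply, Derivation.smul_apply, Derivation.add_apply,
        Derivation.sub_apply, Derivation.leibniz, smul_eq_mul]
      ring

/-- `A ⋊ h` acts on `A` through the anchor. -/
noncomputable instance : LieRingModule (Transformation ρ) A where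
  bracket x a := anchor ρ x a
  add_lie x y a := by
    change anchor ρ (x + y) a = anchor ρ x a + anchor ρ y a
    rw [map_add]; rfl
  lie_add x a b := map_add (anchor ρ x) a b
  leibniz_lie x y a := by
    change anchor ρ x (anchor ρ y a) = anchor ρ ⁅x, y⁆ a + anchor ρ y (anchor ρ x a)
    rw [anchor_lie, Derivation.commutator_apply]; abel

theorem lie_eq_anchor (x : Transformation ρ) (a : A) : ⁅x, a⁆ = anchor ρ x a := rfl

instance : LieRinehartRing A (Transformation ρ) where
  lie_smul_eq_mul' a b x := by simp [lie_eq_anchor]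
  leibniz_mul_right' x a b := by simp [lie_eq_anchor, mul_comm]
  leibniz_smul_right' x y a := by
    rw [lie_eq_anchor]
    induction x using Transformation.induction with
    | zero => simp
    | add x x' hx hx' =>
      simp only [add_lie, map_add, hx, hx', smul_add, Derivation.add_apply, add_smul]; abel
    | tmul f v =>
      induction y using Transformation.induction with
      | zero => simp
      | add x x' hx hx' => simp only [lie_add, hx, hx', smul_add]; abel
      | tmul g w =>
        simp only [smul_tmul, lie_tmul_tmul, smul_add, smul_sub, anchor_tmul,
          Derivation.smul_apply, Derivation.leibniz, smul_eq_mul, mul_add, add_tmul]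
        simp only [mul_assoc, mul_comm, mul_left_comm]
        abel

/-- `A ⋊ h` is a Lie-Rinehart algebra over `A`. -/
instance : LieRinehartAlgebra k A (Transformation ρ) where
  smul_lie r x a := by
    rw [lie_eq_anchor, lie_eq_anchor, ← algebraMap_smul A r x, map_smul, Derivation.smul_apply,
      algebraMap_smul]
  lie_smul r x a := (anchor ρ x).map_smul r a

end Transformation
end LieAlgebra

end LieRinehart

/-! In `A # U(h)` a primitive element `v` satisfies `(f # v)(g # u) = f v(g) # u + f g # v u`. The
first term is the anchor, the second is multiplication in `U(h)`. From this formula the elements `a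
# 1` and `f # v` satisfy all defining relations of the enveloping algebra (`toSmash_lie`,
`toSmash_smul`, `toSmash_mul_smul`), so its universal property gives the algebra morphism
`envelopingToSmash`.

In the other direction `v ↦ ι(1 ⊗ v)` is a Lie morphism, hence extends to `U(h)`, and `a # u ↦ ι(a)
u` is a candidate inverse. Its multiplicativity need not be checked: it suffices that it is
compatible with left multiplication by `A` and by `A ⋊ h` (`smashToEnveloping_toSmash_mul`), because
these operators generate the enveloping algebra from `1`. The inverse being explicit, no basis
theorem of PBW type enters.

For the coalgebra structures the same principle applies. On the enveloping algebra `Δ` and `ε` are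
determined by their values at `1` and their behaviour under left multiplication by `A` and `A ⋊ h`.
The smash product obeys the same rules (`counit_toSmash_mul`, `comul_toSmash_mul`), again because
`v` is primitive. -/

namespace LieRinehart

/-! ### The two factors of a smash product, and its comultiplication -/

namespace SmashProduct

variable {k H R : Type*} [CommRing k] [Ring H] [Bialgebra k H] [CommRing R] [Algebra k R]
  (M : ModuleAlgebra k H R)

variable {M} in
theorem induction {P : SmashProduct M → Prop} (zero : P 0)
    (add : ∀ x y, P x → P y → P (x + y)) (tmul : ∀ r u, P (tmul r u)) (x : SmashProduct M) : P x :=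
  TensorProduct.induction_on (motive := fun x : R ⊗[k] H => P x) x zero tmul add

theorem smul_tmul (r s : R) (u : H) : (r • tmul s u : SmashProduct M) = tmul (r * s) u := rfl

theorem add_tmul (r s : R) (u : H) :
    (tmul (r + s) u : SmashProduct M) = tmul r u + tmul s u := TensorProduct.add_tmul r s u

theorem tmul_add (r : R) (u v : H) :
    (tmul r (u + v) : SmashProduct M) = tmul r u + tmul r v := TensorProduct.tmul_add r u v

theorem tmul_one_mul (r : R) (z : SmashProduct M) : tmul r 1 * z = r • z := by
  rw [mul_def]
  erw [mulMap_tmul]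
  rw [map_one]
  rfl

theorem tmul_mul (r : R) (u : H) (z : SmashProduct M) : tmul r u * z = r • (tmul 1 u * z) := by
  rw [mul_def, mul_def]
  erw [mulMap_tmul, mulMap_tmul]
  rw [one_smul]
  rfl

/-- Since `H` acts on `1` through the counit, the product is `∑ ε(u₁) # u₂ v`, which the counit
axiom collapses. -/
theorem tmul_one_mul_tmul_one (u v : H) :
    (tmul 1 u * tmul 1 v : SmashProduct M) = tmul 1 (u * v) := by
  let c := Coalgebra.Repr.arbitrary k u
  have h := mulMap_tmul_tmul M 1 1 u v c
  have key := congrArg (TensorProduct.map (Algebra.linearMap k R) (LinearMap.mulRight k v))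
    (Coalgebra.sum_counit_tmul_eq c)
  simp only [map_sum, TensorProduct.map_tmul, Algebra.linearMap_apply, map_one,
    LinearMap.mulRight_apply] at key
  simp only [M.act_one, one_mul, key] at h
  exact h

/-- The inclusion of `R` into `R # H`. -/
noncomputable def inl : R →ₐ[k] SmashProduct M :=
  AlgHom.ofLinearMap ((TensorProduct.mk k R H).flip 1) rfl
    (fun a b => (tmul_one_mul M a (tmul b 1)).symm)

theorem inl_apply (r : R) : inl M r = tmul r 1 := rfl

/-- The inclusion of `H` into `R # H`. -/
noncomputable def inr : H →ₐ[k] SmashProduct M :=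
  AlgHom.ofLinearMap (TensorProduct.mk k R H 1) rfl
    (fun u v => (tmul_one_mul_tmul_one M u v).symm)

theorem inr_apply (u : H) : inr M u = tmul 1 u := rfl

theorem inl_mul_inr (r : R) (u : H) : inl M r * inr M u = tmul r u := by
  rw [inl_apply, tmul_one_mul, inr_apply, smul_tmul, mul_one]

/-- The map `u ⊗ v ↦ (1 # u) ⊗ (1 # v)`. -/
noncomputable def tensorInr : H ⊗[k] H →ₗ[k] SmashProduct M ⊗[R] SmashProduct M :=
  TensorProduct.lift
    ((TensorProduct.mk R (SmashProduct M) (SmashProduct M)).restrictScalars₁₂ k k |>.compl₁₂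
      (inr M).toLinearMap (inr M).toLinearMap)

theorem tensorInr_tmul (u v : H) :
    tensorInr M (u ⊗ₜ v) = (tmul 1 u : SmashProduct M) ⊗ₜ[R] (tmul 1 v : SmashProduct M) := rfl

/-- This form, free of chosen representatives, lets the multiplicativity of `Δ` on `H` be used
inside `tensorInr`. -/
theorem comul_tmul_eq (r : R) (u : H) :
    Coalgebra.comul (R := R) (tmul r u : SmashProduct M)
      = r • tensorInr M (Coalgebra.comul u) := by
  have c := Coalgebra.Repr.arbitrary k u
  rw [comul_tmul M r u c, ← c.eq, map_sum, Finset.smul_sum]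
  refine Finset.sum_congr rfl fun i _ => ?_
  rw [tensorInr_tmul, TensorProduct.smul_tmul', smul_tmul, mul_one]

end SmashProduct

/-! ### Left multiplication by a primitive element -/

section TransformationIso

attribute [local instance 100] LieRing.ofAssociativeRing

variable {k A h : Type*} [CommRing k] [CommRing A] [Algebra k A] [LieRing h] [LieAlgebra k h]
  (ρ : h →ₗ⁅k⁆ Derivation k A A)

open UniversalEnvelopingAlgebra (ι)

/-- The two terms come from the two summands of `Δ(v) = v ⊗ 1 + 1 ⊗ v`: either `v` differentiates
`g`, or it passes `g` and multiplies `u`. -/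
theorem SmashProduct.tmul_ι_mul_tmul (f g : A) (v : h) (u : UniversalEnvelopingAlgebra k h) :
    (tmul f (ι k v) * tmul g u : SmashProduct (ueaModuleAlgebra ρ)) =
      tmul (f * ρ v g) u + tmul (f * g) (ι k v * u) := by
  have hc : Coalgebra.comul (R := k) (ι k v) = ι k v ⊗ₜ 1 + 1 ⊗ₜ ι k v := ueaComul_ι k v
  rw [tmul_mul, mul_def]
  erw [mulMap_tmul, ModuleAlgebra.diag_tmul, hc]
  rw [map_add, TensorProduct.map_tmul, TensorProduct.map_tmul, one_smul]
  simp only [LinearMap.flip_apply, AlgHom.toLinearMap_apply, LinearMap.mulRight_apply, one_mul,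
    map_one, Module.End.one_apply]
  have ha : (ueaModuleAlgebra ρ).act (ι k v) g = ρ v g := ueaAct_ι ρ v g
  rw [ha]
  exact smul_add f (tmul (ρ v g) u : SmashProduct (ueaModuleAlgebra ρ)) (tmul g (ι k v * u))

theorem counit_ι_mul (v : h) (u : UniversalEnvelopingAlgebra k h) :
    Coalgebra.counit (R := k) (ι k v * u) = 0 := by
  have hc : Coalgebra.counit (R := k) (ι k v) = 0 := ueaCounit_ι k v
  rw [Bialgebra.counit_mul, hc, zero_mul]

theorem comul_ι_mul (v : h) (u : UniversalEnvelopingAlgebra k h) :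
    Coalgebra.comul (R := k) (ι k v * u) =
      (ι k v ⊗ₜ 1 + 1 ⊗ₜ ι k v) * Coalgebra.comul (R := k) u := by
  have hc : Coalgebra.comul (R := k) (ι k v) = ι k v ⊗ₜ 1 + 1 ⊗ₜ ι k v := ueaComul_ι k v
  rw [Bialgebra.comul_mul, hc]

/-! ### The defining relations of the enveloping algebra inside the smash product -/

namespace Transformation

/-- The map `f ⊗ v ↦ f # v`. -/
noncomputable def toSmash : Transformation ρ →ₗ[k] SmashProduct (ueaModuleAlgebra ρ) :=
  LinearMap.lTensor A (ι k : h →ₗ⁅k⁆ UniversalEnvelopingAlgebra k h).toLinearMap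

theorem toSmash_tmul (f : A) (v : h) :
    toSmash ρ (tmul f v) = SmashProduct.tmul f (ι k v) := rfl

theorem toSmash_smul (a : A) (x : Transformation ρ) :
    toSmash ρ (a • x) = a • toSmash ρ x := by
  induction x using Transformation.induction with
  | zero => simp
  | add x y hx hy => simp only [smul_add, map_add, hx, hy]
  | tmul f v => rfl

/-- On pure tensors this is the product rule for `ρ v` applied to `a g`. At `z = 1` it becomes the
anchor relation; for general `z` it is the hypothesis under which `x ⊗ 1 + 1 ⊗ x` is well defined on
a tensor product over `A`. -/
theorem toSmash_mul_smul (x : Transformation ρ) (a : A) (z : SmashProduct (ueaModuleAlgebra ρ)) :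
    toSmash ρ x * a • z = a • (toSmash ρ x * z) + ⁅x, a⁆ • z := by
  induction x using Transformation.induction with
  | zero => simp
  | add x y hx hy => simp only [map_add, add_mul, hx, hy, smul_add, add_lie, add_smul]; abel
  | tmul f v =>
    induction z using SmashProduct.induction with
    | zero => simp
    | add x y hx hy => simp only [smul_add, mul_add, hx, hy]; abel
    | tmul g u =>
      simp only [toSmash_tmul, SmashProduct.smul_tmul, SmashProduct.tmul_ι_mul_tmul, smul_add,
        lie_eq_anchor, anchor_tmul, Derivation.leibniz, Derivation.smul_apply, smul_eq_mul,
        mul_add, SmashProduct.add_tmul]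
      simp only [mul_comm, mul_left_comm]
      abel

/-- In the commutator of `f # v` and `g # w` the terms quadratic in `h` combine to `f g # (v w - w
v)`, as `A` is commutative. The remaining terms are the two anchor terms of the bracket. -/
theorem toSmash_lie (x y : Transformation ρ) :
    toSmash ρ ⁅x, y⁆ = toSmash ρ x * toSmash ρ y - toSmash ρ y * toSmash ρ x := by
  induction x using Transformation.induction with
  | zero => simp
  | add x x' hx hx' => simp only [add_lie, map_add, hx, hx', add_mul, mul_add]; abel
  | tmul f v =>
    induction y using Transformation.induction with
    | zero => simp
    | add x x' hx hx' => simp only [lie_add, map_add, hx, hx', add_mul, mul_add]; abel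
    | tmul g w =>
      -- Rewriting only `v w` brings both quadratic terms to the order `w v`, where they cancel.
      have hl : ι k v * ι k w = ι k ⁅v, w⁆ + ι k w * ι k v := by
        rw [LieHom.map_lie, LieRing.of_associative_ring_bracket, sub_add_cancel]
      simp only [lie_tmul_tmul, map_add, map_sub, toSmash_tmul, SmashProduct.tmul_ι_mul_tmul,
        hl, SmashProduct.tmul_add, mul_comm g f]
      abel

end Transformation

/-! ### The two mutually inverse maps -/

open Transformation

/-- The morphism `𝒰_A(A ⋊ h) → A # U(h)`. -/
noncomputable def envelopingToSmash :
    Enveloping k A (Transformation ρ) →ₐ[k] SmashProduct (ueaModuleAlgebra ρ) :=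
  Enveloping.lift (SmashProduct.inl _) (toSmash ρ) (toSmash_lie ρ)
    (fun a x => by rw [toSmash_smul, SmashProduct.inl_apply, SmashProduct.tmul_one_mul])
    (fun x a => by
      -- The Leibniz rule at `1`, with scalars read as left multiplication by `a # 1`, is the anchor
      -- relation.
      have h1 := toSmash_mul_smul ρ x a 1
      simp only [← SmashProduct.tmul_one_mul, mul_one] at h1
      rw [SmashProduct.inl_apply, h1, SmashProduct.tmul_one_mul, add_sub_cancel_left]
      rfl)

theorem envelopingToSmash_ιA (a : A) :
    envelopingToSmash ρ (Enveloping.ιA k A _ a) = SmashProduct.tmul a 1 :=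
  Enveloping.lift_ιA ..

theorem envelopingToSmash_ιL (x : Transformation ρ) :
    envelopingToSmash ρ (Enveloping.ιL k A _ x) = toSmash ρ x :=
  Enveloping.lift_ιL ..

theorem envelopingToSmash_smul (a : A) (u : Enveloping k A (Transformation ρ)) :
    envelopingToSmash ρ (a • u) = a • envelopingToSmash ρ u := by
  rw [Enveloping.smul_def, map_mul, envelopingToSmash_ιA, SmashProduct.tmul_one_mul]

/-- The morphism `U(h) → 𝒰_A(A ⋊ h)` which extends `v ↦ ι(1 ⊗ v)`. -/
noncomputable def ueaToEnveloping :
    UniversalEnvelopingAlgebra k h →ₐ[k] Enveloping k A (Transformation ρ) :=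
  UniversalEnvelopingAlgebra.lift k
    { Enveloping.ιL k A (Transformation ρ) ∘ₗ (TensorProduct.mk k A h 1) with
      map_lie' := fun {v w} => by
        change Enveloping.ιL k A (Transformation ρ) (tmul 1 ⁅v, w⁆) = _ * _ - _ * _
        -- The anchor terms of the bracket vanish because derivations kill `1`.
        have hl : (tmul 1 ⁅v, w⁆ : Transformation ρ) =
            ⁅(tmul 1 v : Transformation ρ), (tmul 1 w : Transformation ρ)⁆ := by
          have h0 (v : h) : (tmul 0 v : Transformation ρ) = 0 := TensorProduct.zero_tmul ..
          simp [lie_tmul_tmul, h0]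
        rw [hl, Enveloping.ιL_lie]
        rfl }

theorem ueaToEnveloping_ι (v : h) :
    ueaToEnveloping ρ (ι k v) = Enveloping.ιL k A (Transformation ρ) (tmul 1 v) :=
  UniversalEnvelopingAlgebra.lift_ι_apply ..

/-- The map `a # u ↦ ι(a) u`, where `u ∈ U(h)`. -/
noncomputable def smashToEnveloping :
    SmashProduct (ueaModuleAlgebra ρ) →ₗ[k] Enveloping k A (Transformation ρ) :=
  TensorProduct.lift ((LinearMap.mul k (Enveloping k A (Transformation ρ))).compl₁₂
    (Enveloping.ιA k A (Transformation ρ)).toLinearMap (ueaToEnveloping ρ).toLinearMap)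

theorem smashToEnveloping_tmul (a : A) (u : UniversalEnvelopingAlgebra k h) :
    smashToEnveloping ρ (SmashProduct.tmul a u) =
      Enveloping.ιA k A _ a * ueaToEnveloping ρ u := rfl

theorem envelopingToSmash_comp_ueaToEnveloping :
    (envelopingToSmash ρ).comp (ueaToEnveloping ρ) = SmashProduct.inr (ueaModuleAlgebra ρ) := by
  refine uea_hom_ext k fun v => ?_
  rw [AlgHom.comp_apply, ueaToEnveloping_ι, envelopingToSmash_ιL, toSmash_tmul,
    SmashProduct.inr_apply]

/-- As `a # u = (a # 1)(1 # u)` and `envelopingToSmash` is multiplicative, the factors can be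
treated separately. On `U(h)` the composite is an algebra morphism, so it is determined on `h`. -/
theorem envelopingToSmash_smashToEnveloping (z : SmashProduct (ueaModuleAlgebra ρ)) :
    envelopingToSmash ρ (smashToEnveloping ρ z) = z := by
  induction z using SmashProduct.induction with
  | zero => simp
  | add x y hx hy => rw [map_add, map_add, hx, hy]
  | tmul a u =>
    rw [smashToEnveloping_tmul, map_mul, envelopingToSmash_ιA, ← AlgHom.comp_apply,
      envelopingToSmash_comp_ueaToEnveloping, ← SmashProduct.inl_apply, SmashProduct.inl_mul_inr]

theorem smashToEnveloping_smul (a : A) (z : SmashProduct (ueaModuleAlgebra ρ)) :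
    smashToEnveloping ρ (a • z) = Enveloping.ιA k A _ a * smashToEnveloping ρ z := by
  induction z using SmashProduct.induction with
  | zero => simp
  | add x y hx hy => simp only [smul_add, map_add, hx, hy, mul_add]
  | tmul b u =>
    rw [SmashProduct.smul_tmul, smashToEnveloping_tmul, smashToEnveloping_tmul, map_mul, mul_assoc]

/-- This replaces multiplicativity of the inverse. Moving `ι(1 ⊗ v)` past `ι(g)` in `ι(f) ι(1 ⊗ v)
ι(g) u` produces the same two terms as the product `(f # v)(g # u)`. -/
theorem smashToEnveloping_toSmash_mul (x : Transformation ρ)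
    (z : SmashProduct (ueaModuleAlgebra ρ)) :
    smashToEnveloping ρ (toSmash ρ x * z) = Enveloping.ιL k A _ x * smashToEnveloping ρ z := by
  induction x using Transformation.induction with
  | zero => simp
  | add x y hx hy => simp only [map_add, add_mul, hx, hy]
  | tmul f v =>
    induction z using SmashProduct.induction with
    | zero => simp
    | add x y hx hy => simp only [mul_add, map_add, hx, hy]
    | tmul g u =>
      -- The morphism from `U(h)` only meets elements `1 ⊗ v`, so the coefficient `f` is split off.
      have hf : (tmul f v : Transformation ρ) = f • tmul 1 v := by
        rw [Transformation.smul_tmul, mul_one]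
      have hg : ⁅(tmul 1 v : Transformation ρ), g⁆ = ρ v g := by
        rw [lie_eq_anchor, anchor_tmul, one_smul]
      rw [toSmash_tmul, SmashProduct.tmul_ι_mul_tmul, map_add, smashToEnveloping_tmul,
        smashToEnveloping_tmul, smashToEnveloping_tmul, hf, Enveloping.ιL_smul, map_mul, map_mul,
        map_mul, ueaToEnveloping_ι, mul_assoc (Enveloping.ιA k A _ f) (Enveloping.ιL k A _ _),
        ← mul_assoc (Enveloping.ιL k A _ _) (Enveloping.ιA k A _ g), Enveloping.ιL_mul_ιA, hg]
      simp only [mul_add, add_mul, mul_assoc]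
      abel

/-- The composite fixes `1` and commutes with left multiplication by the generators. -/
theorem smashToEnveloping_envelopingToSmash (u : Enveloping k A (Transformation ρ)) :
    smashToEnveloping ρ (envelopingToSmash ρ u) = u := by
  induction u using Enveloping.induction with
  | one => simp [SmashProduct.one_def, smashToEnveloping_tmul]
  | add u v hu hv => rw [map_add, map_add, hu, hv]
  | mulA a u hu =>
    rw [← Enveloping.smul_def, envelopingToSmash_smul, smashToEnveloping_smul, hu,
      Enveloping.smul_def]
  | mulL x u hu => rw [map_mul, envelopingToSmash_ιL, smashToEnveloping_toSmash_mul, hu]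

/-- The isomorphism of algebras `𝒰_A(A ⋊ h) ≃ A # U(h)`. -/
noncomputable def envelopingEquivSmash :
    Enveloping k A (Transformation ρ) ≃ₐ[k] SmashProduct (ueaModuleAlgebra ρ) :=
  { envelopingToSmash ρ with
    invFun := smashToEnveloping ρ
    left_inv := smashToEnveloping_envelopingToSmash ρ
    right_inv := envelopingToSmash_smashToEnveloping ρ }

/-! ### Compatibility with the counits -/

/-- The term `f g # v u` dies since `ε(v) = 0`. The other gives `f v(g) ε(u)`, which is the anchor
applied to `g ε(u)`, as `ε(u)` is a scalar of `k`. -/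
theorem counit_toSmash_mul (x : Transformation ρ) (z : SmashProduct (ueaModuleAlgebra ρ)) :
    Coalgebra.counit (R := A) (toSmash ρ x * z) = ⁅x, Coalgebra.counit (R := A) z⁆ := by
  induction x using Transformation.induction with
  | zero => simp
  | add x y hx hy => simp only [map_add, add_mul, hx, hy, add_lie]
  | tmul f v =>
    induction z using SmashProduct.induction with
    | zero => simp
    | add x y hx hy => simp only [mul_add, map_add, hx, hy, lie_add]
    | tmul g u =>
      rw [toSmash_tmul, SmashProduct.tmul_ι_mul_tmul, map_add, SmashProduct.counit_tmul,
        SmashProduct.counit_tmul, SmashProduct.counit_tmul, counit_ι_mul, lie_eq_anchor,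
        anchor_tmul]
      simp [mul_comm]

theorem counit_envelopingToSmash (u : Enveloping k A (Transformation ρ)) :
    Coalgebra.counit (R := A) (envelopingToSmash ρ u) = Coalgebra.counit (R := A) u := by
  induction u using Enveloping.induction with
  | one =>
    rw [Enveloping.counit_one, map_one, SmashProduct.one_def, SmashProduct.counit_tmul,
      Bialgebra.counit_one, map_one, mul_one]
  | add u v hu hv => rw [map_add, map_add, map_add, hu, hv]
  | mulA a u hu =>
    rw [← Enveloping.smul_def, envelopingToSmash_smul, map_smul, map_smul, hu]
  | mulL x u hu =>
    rw [map_mul, envelopingToSmash_ιL, counit_toSmash_mul, hu, Enveloping.counit_ιL_mul]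

/-! ### Compatibility with the comultiplications -/

/-- The operator `x ⊗ 1 + 1 ⊗ x` on the tensor square of `A # U(h)`. -/
noncomputable def smashDiag (x : Transformation ρ) :
    Module.End k (SmashProduct (ueaModuleAlgebra ρ) ⊗[A] SmashProduct (ueaModuleAlgebra ρ)) :=
  Enveloping.leibnizTensor (fun a => ⁅x, a⁆) (LinearMap.mulLeft k (toSmash ρ x))
    (toSmash_mul_smul ρ x) (LinearMap.mulLeft k (toSmash ρ x)) (toSmash_mul_smul ρ x)

theorem smashDiag_tmul (x : Transformation ρ) (y z : SmashProduct (ueaModuleAlgebra ρ)) :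
    smashDiag ρ x (y ⊗ₜ z) = (toSmash ρ x * y) ⊗ₜ z + y ⊗ₜ (toSmash ρ x * z) := rfl

theorem smashDiag_smul (x : Transformation ρ) (a : A)
    (z : SmashProduct (ueaModuleAlgebra ρ) ⊗[A] SmashProduct (ueaModuleAlgebra ρ)) :
    smashDiag ρ x (a • z) = a • smashDiag ρ x z + ⁅x, a⁆ • z :=
  Enveloping.leibnizTensor_smul ..

theorem smashDiag_add (x y : Transformation ρ)
    (z : SmashProduct (ueaModuleAlgebra ρ) ⊗[A] SmashProduct (ueaModuleAlgebra ρ)) :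
    smashDiag ρ (x + y) z = smashDiag ρ x z + smashDiag ρ y z := by
  induction z with
  | zero => simp
  | add z w hz hw => simp only [map_add, hz, hw]; abel
  | tmul p q =>
    simp only [smashDiag_tmul, map_add, add_mul, TensorProduct.add_tmul, TensorProduct.tmul_add]
    abel

theorem smashDiag_zero
    (z : SmashProduct (ueaModuleAlgebra ρ) ⊗[A] SmashProduct (ueaModuleAlgebra ρ)) :
    smashDiag ρ 0 z = 0 := by
  simpa using smashDiag_add ρ 0 0 z

/-- Because `v(1) = 0`, left multiplication by `f # v` sends `1 # p` to `f • (1 # v p)`, with no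
anchor term. The coefficient `f` leaves either tensor factor since the tensor product is over `A`,
and what remains is multiplication by `Δ(v)`. -/
theorem smashDiag_tensorInr (f : A) (v : h)
    (c : UniversalEnvelopingAlgebra k h ⊗[k] UniversalEnvelopingAlgebra k h) :
    smashDiag ρ (tmul f v) (SmashProduct.tensorInr _ c) =
      f • SmashProduct.tensorInr _ ((ι k v ⊗ₜ 1 + 1 ⊗ₜ ι k v) * c) := by
  induction c with
  | zero => simp
  | add c d hc hd => simp only [map_add, mul_add, smul_add, hc, hd]
  | tmul p q =>
    have hp (p : UniversalEnvelopingAlgebra k h) :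
        (toSmash ρ (tmul f v) * SmashProduct.tmul 1 p : SmashProduct (ueaModuleAlgebra ρ)) =
          f • SmashProduct.tmul 1 (ι k v * p) := by
      have h0 : (SmashProduct.tmul 0 p : SmashProduct (ueaModuleAlgebra ρ)) = 0 :=
        TensorProduct.zero_tmul ..
      rw [toSmash_tmul, SmashProduct.tmul_ι_mul_tmul, Derivation.map_one_eq_zero, mul_zero, h0,
        zero_add, SmashProduct.smul_tmul]
    rw [SmashProduct.tensorInr_tmul, smashDiag_tmul, hp, hp, add_mul,
      Algebra.TensorProduct.tmul_mul_tmul, Algebra.TensorProduct.tmul_mul_tmul, one_mul, one_mul,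
      map_add, SmashProduct.tensorInr_tmul, SmashProduct.tensorInr_tmul, smul_add,
      TensorProduct.smul_tmul', TensorProduct.tmul_smul]

/-- With `Δ(g # u)` written as `g` times the image of `Δ(u)`, the Leibniz rule for the diagonal
operator yields an anchor term matching `Δ(f v(g) # u)` and a term matching `Δ(f g # v u)`, by `Δ(v
u) = Δ(v) Δ(u)`. -/
theorem comul_toSmash_mul (x : Transformation ρ) (z : SmashProduct (ueaModuleAlgebra ρ)) :
    Coalgebra.comul (R := A) (toSmash ρ x * z) = smashDiag ρ x (Coalgebra.comul (R := A) z) := by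
  induction x using Transformation.induction with
  | zero => simp [smashDiag_zero]
  | add x y hx hy => simp only [map_add, add_mul, hx, hy, smashDiag_add]
  | tmul f v =>
    induction z using SmashProduct.induction with
    | zero => simp
    | add x y hx hy => simp only [mul_add, map_add, hx, hy]
    | tmul g u =>
      rw [toSmash_tmul, SmashProduct.tmul_ι_mul_tmul, map_add, SmashProduct.comul_tmul_eq,
        SmashProduct.comul_tmul_eq, SmashProduct.comul_tmul_eq, smashDiag_smul,
        smashDiag_tensorInr, comul_ι_mul, smul_smul, lie_eq_anchor, anchor_tmul, mul_comm g f,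
        add_comm]
      rfl

/-! ### The isomorphism of coalgebras -/

/-- The isomorphism of `A`-modules `𝒰_A(A ⋊ h) ≃ A # U(h)`. -/
noncomputable def envelopingLinearEquivSmash :
    Enveloping k A (Transformation ρ) ≃ₗ[A] SmashProduct (ueaModuleAlgebra ρ) :=
  { envelopingEquivSmash ρ with
    map_smul' := envelopingToSmash_smul ρ }

theorem envelopingLinearEquivSmash_apply (u : Enveloping k A (Transformation ρ)) :
    envelopingLinearEquivSmash ρ u = envelopingToSmash ρ u := rfl

theorem map_diagL (x : Transformation ρ)
    (z : Enveloping k A (Transformation ρ) ⊗[A] Enveloping k A (Transformation ρ)) :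
    TensorProduct.map (envelopingLinearEquivSmash ρ).toLinearMap
        (envelopingLinearEquivSmash ρ).toLinearMap (Enveloping.diagL x z) =
      smashDiag ρ x (TensorProduct.map (envelopingLinearEquivSmash ρ).toLinearMap
        (envelopingLinearEquivSmash ρ).toLinearMap z) := by
  induction z with
  | zero => simp
  | add z w hz hw => simp only [map_add, hz, hw]
  | tmul u v =>
    simp only [Enveloping.diagL_tmul, map_add, TensorProduct.map_tmul, LinearEquiv.coe_coe,
      envelopingLinearEquivSmash_apply, map_mul, envelopingToSmash_ιL, smashDiag_tmul]

/-- Both sides send `1` to `1 ⊗ 1`, are `A`-linear, and turn left multiplication by `ι(x)` into the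
diagonal operator of `x`; these rules determine a map on the enveloping algebra. -/
theorem map_comul (u : Enveloping k A (Transformation ρ)) :
    TensorProduct.map (envelopingLinearEquivSmash ρ).toLinearMap
        (envelopingLinearEquivSmash ρ).toLinearMap (Coalgebra.comul (R := A) u) =
      Coalgebra.comul (R := A) (envelopingToSmash ρ u) := by
  induction u using Enveloping.induction with
  | one =>
    rw [Enveloping.comul_one, TensorProduct.map_tmul, LinearEquiv.coe_coe,
      envelopingLinearEquivSmash_apply, map_one, SmashProduct.one_def,
      SmashProduct.comul_tmul_eq, Bialgebra.comul_one, one_smul]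
    rfl
  | add u v hu hv => rw [map_add, map_add, map_add, map_add, hu, hv]
  | mulA a u hu =>
    rw [← Enveloping.smul_def, envelopingToSmash_smul, map_smul, map_smul, map_smul, hu]
  | mulL x u hu =>
    rw [map_mul (envelopingToSmash ρ), envelopingToSmash_ιL, comul_toSmash_mul, Enveloping.comul_ιL_mul,
      map_diagL, hu]

/-- The isomorphism of `A`-coalgebras `𝒰_A(A ⋊ h) ≃ A # U(h)`. -/
noncomputable def envelopingCoalgEquivSmash :
    Enveloping k A (Transformation ρ) ≃ₗc[A] SmashProduct (ueaModuleAlgebra ρ) :=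
  { envelopingLinearEquivSmash ρ with
    counit_comp := LinearMap.ext (counit_envelopingToSmash ρ)
    map_comp_comul := LinearMap.ext (map_comul ρ) }

end TransformationIso

end LieRinehart

theorem proposition4p4 {k A h : Type*} [Field k] [CharZero k] [CommRing A] [Algebra k A]
    [LieRing h] [LieAlgebra k h] (ρ : h →ₗ⁅k⁆ Derivation k A A) :
    ∃ (Φ : LieRinehart.Enveloping k A (LieRinehart.Transformation ρ) ≃ₐ[k]
          LieRinehart.SmashProduct (LieRinehart.ueaModuleAlgebra ρ))
      (Ψ : LieRinehart.Enveloping k A (LieRinehart.Transformation ρ) ≃ₗc[A]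
          LieRinehart.SmashProduct (LieRinehart.ueaModuleAlgebra ρ)),
      (∀ u, Ψ u = Φ u) ∧
      (∀ a : A, Φ (LieRinehart.Enveloping.ιA k A (LieRinehart.Transformation ρ) a) =
        LieRinehart.SmashProduct.tmul a 1) ∧
      (∀ (f : A) (v : h), Φ (LieRinehart.Enveloping.ιL k A (LieRinehart.Transformation ρ)
          (LieRinehart.Transformation.tmul f v)) =
        LieRinehart.SmashProduct.tmul f (UniversalEnvelopingAlgebra.ι k v)) :=
  -- Both equivalences have `envelopingToSmash` as underlying function, so they agree by definition.
  ⟨LieRinehart.envelopingEquivSmash ρ, LieRinehart.envelopingCoalgEquivSmash ρ, fun _ => rfl,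
    LieRinehart.envelopingToSmash_ιA ρ, fun f v => LieRinehart.envelopingToSmash_ιL ρ (.tmul f v)⟩
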